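/- Let $R$ be an arbitrary commutative ring, $n\ge 1$, and $A$ an $n\times(n-1)$ matrix over $R$. Let $\Delta=[\Delta_1\ \cdots\ \Delta_n]$ be the row of signed maximal minors of $A$, i.e. $\Delta_i=(-1)^{i-1}\det(A\text{ with row }i\text{ deleted})$, so that $\det[X\mid A]=\Delta_1X_1+\cdots+\Delta_nX_n$ for every column $X$. Definitions. For a finitely generated ideal $I$ of $R$ and $k\ge 0$, write $\mathrm{Gr}(I)\ge k$ if there are polynomials $f_1,\dots,f_k$ over $R$, involving pairwise disjoint sets of indeterminates, such that the coefficients of each $f_j$ generate $I$, and such that $(f_1,\dots,f_k)$ is a regular sequence in the polynomial ring (each $f_j$ is a nonzerodivisor modulo $f_1,\dots,f_{j-1}$; the sequence may generate the unit ideal). This does not depend on the choice of the $f_j$, and $\mathrm{Gr}(I)\ge 0$ always holds. Put $\mathrm{Gr}(a_1,\dots,a_m)=\mathrm{Gr}(\langle a_1,\dots,a_m\rangle)$. A finite family $(a_1,\dots,a_m)$ is coregular if the ideal it generates has zero annihilator. An element $g$ is a strong gcd of a family $(a_1,\dots,a_m)$ if the family is coregular, $g$ divides every $a_i$, and for every nonzerodivisor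 $y$ and every $x\in R$, if $y$ divides all the $xa_i$ then $y$ divides $xg$. It is a strong gcd of a finitely generated ideal if it is a strong gcd of every finite system of generators of that ideal. Then: (1) The ideal generated by the minors of order $n-1$ of $A$ is $\langle\Delta_1,\dots,\Delta_n\rangle$, and $$0\to R^{n-1}\xrightarrow{\ A\ }R^n\xrightarrow{\ \Delta\ }R$$ is a complex. It is exact if and only if $\mathrm{Gr}(\Delta_1,\dots,\Delta_n)\ge 2$. If $\mathrm{Gr}(\Delta_1,\dots,\Delta_n)\ge 3$, then $1\in\langle\Delta_1,\dots,\Delta_n\rangle$. (2) (Hilbert–Burch) Let $\alpha=[a_1\ \cdots\ a_n]$ be a row over $R$ such that $$0\to R^{n-1}\xrightarrow{\ A\ }R^n\xrightarrow{\ \alpha\ }R$$ is exact, and let $\mathfrak a=\langle a_1,\dots,a_n\rangle$. Then (a) there is a unique nonzerodivisor $a\in R$ such that $\alpha=a\,\Delta$, and $a$ is a strong gcd of $(a_1,\dots,a_n)$ and of the ideal $\mathfrak a$; (b) $\mathrm{Gr}(\Delta_1,\dots,\Delta_n)\ge 2$; (c) if $\mathrm{Gr}(\Delta_1,\dots,\Delta_n)\ge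 3$, then $1\in\langle\Delta_1,\dots,\Delta_n\rangle$ and $\mathfrak a$ is a principal ideal. -/

import Mathlib

namespace HilbertBurch

open Matrix

variable {R : Type*} [CommRing R]

/-- The content ideal `c(f)` of a multivariate polynomial: the ideal generated by its
coefficients. -/
def contentIdeal {σ : Type*} (f : MvPolynomial σ R) : Ideal R :=
  Ideal.span (Set.range fun m : σ →₀ ℕ => MvPolynomial.coeff m f)

/-- A Kronecker sequence of length `k` attached to the ideal `I`: polynomials `f₁, …, f_k`
over `R`, each with content ideal `I`, involving pairwise disjoint sets of variables
(taken from a countable supply). -/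
structure IsKroneckerSeq (I : Ideal R) {k : ℕ} (f : Fin k → MvPolynomial ℕ R) : Prop where
  content_eq : ∀ i, contentIdeal (f i) = I
  disjoint_vars : ∀ i j, i ≠ j → Disjoint (f i).vars (f j).vars

/-- `DepthGE I k` is `Gr_R(I) ≥ k` (true grade, in the sense of Hochster and Northcott) for a
finitely generated ideal `I`: a Kronecker sequence of length `k` attached to `I` is a regular
sequence in the polynomial ring (this does not depend on the Kronecker sequence). As usual in
this setting, a regular sequence is not required to generate a proper ideal. -/
def DepthGE (I : Ideal R) (k : ℕ) : Prop :=
  ∃ f : Fin k → MvPolynomial ℕ R, IsKroneckerSeq I f ∧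
    RingTheory.Sequence.IsWeaklyRegular (MvPolynomial ℕ R) (List.ofFn f)

/-- A finite family is coregular if the ideal that it generates is faithful. -/
def IsCoregular {ι : Type*} (a : ι → R) : Prop :=
  ∀ x : R, (∀ i, x * a i = 0) → x = 0

/-- `g` is a strong gcd of the finite family `a`. -/
structure IsStrongGcd {ι : Type*} (a : ι → R) (g : R) : Prop where
  coregular : IsCoregular a
  dvd : ∀ i, g ∣ a i
  dvd_of_dvd : ∀ y ∈ nonZeroDivisors R, ∀ x : R, (∀ i, y ∣ x * a i) → y ∣ x * g

/-- `g` is a strong gcd of the finitely generated ideal `I`: it is a strong gcd of every finite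
system of generators of `I`. -/
def IsStrongGcdOfIdeal (I : Ideal R) (g : R) : Prop :=
  I.FG ∧ ∀ (m : ℕ) (b : Fin m → R), Ideal.span (Set.range b) = I → IsStrongGcd b g

/-- The ideal generated by the minors of order `k` of a matrix. -/
def determinantalIdeal {m p : ℕ} (A : Matrix (Fin m) (Fin p) R) (k : ℕ) : Ideal R :=
  Ideal.span {d | ∃ (r : Fin k ↪o Fin m) (c : Fin k ↪o Fin p), d = (A.submatrix r c).det}

/-- The signed minors of order `n` of a matrix with `n + 1` rows and `n` columns (rows are
indexed from `0`): `Δ i` is `(-1) ^ i` times the minor obtained by deleting row `i`. -/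
def signedMinors {n : ℕ} (A : Matrix (Fin (n + 1)) (Fin n) R) : Fin (n + 1) → R :=
  fun i => (-1) ^ (i : ℕ) * (A.submatrix i.succAbove id).det

/-- The determinant of `A` with a column `X` put in front of it is `∑ Δ i * X i`. -/
theorem det_cons_column {n : ℕ} (A : Matrix (Fin (n + 1)) (Fin n) R) (X : Fin (n + 1) → R) :
    (Matrix.of fun i => (Fin.cons (X i) (A i) : Fin (n + 1) → R)).det =
      ∑ i, signedMinors A i * X i := by
  rw [Matrix.det_succ_column_zero]
  refine Finset.sum_congr rfl fun i _ => ?_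
  have h : ((Matrix.of fun i => (Fin.cons (X i) (A i) : Fin (n + 1) → R)).submatrix
      i.succAbove Fin.succ) = A.submatrix i.succAbove id := by
    ext j k
    simp
  rw [h]
  simp only [signedMinors, Matrix.of_apply, Fin.cons_zero]
  ring

/-- The linear form `Rᵐ → R` with matrix the row `α`, i.e. `v ↦ ∑ i, α i * v i`. -/
def rowMap {m : ℕ} (α : Fin m → R) : (Fin m → R) →ₗ[R] R where
  toFun v := α ⬝ᵥ v
  map_add' := dotProduct_add α
  map_smul' c v := dotProduct_smul c α v

/-- The sequence `0 → Rᵖ → Rᵐ → R`, whose maps have the matrices `A` and `α`, is exact. -/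
def IsExactSeq {m p : ℕ} (A : Matrix (Fin m) (Fin p) R) (α : Fin m → R) : Prop :=
  Function.Injective A.mulVecLin ∧ Function.Exact A.mulVecLin (rowMap α)

end HilbertBurch

open HilbertBurch

namespace HilbertBurch

open Matrix

variable {R : Type*} [CommRing R]

/-! ### Cramer identities for the signed minors. -/

section SignedMinors

variable {n : ℕ}

/-! Two tools carry the proof. Cramer's rule for `[eᵢ | A]`, of determinant `Δᵢ`, makes each `Δᵢ` a
denominator for systems in `A` and makes every row killed by `A` proportional to `Δ`. McCoy's
theorem (`isCoregular_signedMinors_of_injective`) says that injectivity of `A` makes `Δ` faithful.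

If the sequence is exact, `A` stays injective modulo any nonzerodivisor `g`, so `Δ` is faithful
modulo `g`. Over the polynomial ring, with `g` a Kronecker polynomial of `Δ`, this gives depth two.
Conversely, depth two turns a family proportional to `Δ` into a multiple of `Δ`
(`DepthGE.exists_smul_eq`); this removes the Cramer denominators, hence exactness, and also yields
`α = a • Δ` and the strong gcd property.

In depth three the denominators also disappear for the transpose (`exists_vecMul_eq_of_regular`):
`A` has a left inverse, so it stays injective modulo the ideal of `Δ`, and McCoy's theorem there
gives `1 = 0`. -/

theorem signedMinors_map {T : Type*} [CommRing T] (φ : R →+* T)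
    (A : Matrix (Fin (n + 1)) (Fin n) R) (i : Fin (n + 1)) :
    signedMinors (A.map φ) i = φ (signedMinors A i) := by
  simp only [signedMinors, map_mul, map_pow, map_neg, map_one, RingHom.map_det]
  rfl

/-- The square matrix obtained from `A` by putting the column `X` in front of it. -/
def consColumn (X : Fin (n + 1) → R) (A : Matrix (Fin (n + 1)) (Fin n) R) :
    Matrix (Fin (n + 1)) (Fin (n + 1)) R :=
  Matrix.of fun i => Fin.cons (X i) (A i)

theorem det_consColumn (X : Fin (n + 1) → R) (A : Matrix (Fin (n + 1)) (Fin n) R) :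
    (consColumn X A).det = signedMinors A ⬝ᵥ X :=
  det_cons_column A X

theorem det_consColumn_single (i : Fin (n + 1)) (A : Matrix (Fin (n + 1)) (Fin n) R) :
    (consColumn (Pi.single i 1) A).det = signedMinors A i := by
  simp [det_consColumn]

theorem adjugate_consColumn_zero (X : Fin (n + 1) → R) (A : Matrix (Fin (n + 1)) (Fin n) R) :
    (consColumn X A).adjugate 0 = signedMinors A := by
  ext j
  rw [adjugate_fin_succ_eq_det_submatrix, signedMinors]
  congr 1

theorem consColumn_mulVec (X : Fin (n + 1) → R) (A : Matrix (Fin (n + 1)) (Fin n) R)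
    (u : Fin (n + 1) → R) : consColumn X A *ᵥ u = u 0 • X + A *ᵥ Fin.tail u := by
  ext i
  simp [consColumn, mulVec, dotProduct, Fin.sum_univ_succ, Fin.tail, mul_comm]

theorem vecMul_consColumn (X : Fin (n + 1) → R) (A : Matrix (Fin (n + 1)) (Fin n) R)
    (c : Fin (n + 1) → R) :
    c ᵥ* consColumn X A = Fin.cons (c ⬝ᵥ X) (c ᵥ* A) := by
  ext j
  refine Fin.cases ?_ (fun j => ?_) j <;> simp [consColumn, vecMul, dotProduct]

theorem signedMinors_vecMul (A : Matrix (Fin (n + 1)) (Fin n) R) : signedMinors A ᵥ* A = 0 := by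
  ext j
  have h := det_consColumn (fun i => A i j) A
  rw [det_zero_of_column_eq (Fin.succ_ne_zero j).symm (fun i => by simp [consColumn])] at h
  exact h.symm

/-- Since `c` kills `A`, `c [eᵢ | A] = (cᵢ, 0, …, 0)`; multiply by the adjugate, whose first row is
`Δ`. -/
theorem mul_signedMinors_comm_of_vecMul_eq_zero {A : Matrix (Fin (n + 1)) (Fin n) R}
    {c : Fin (n + 1) → R} (hc : c ᵥ* A = 0) (i j : Fin (n + 1)) :
    signedMinors A i * c j = signedMinors A j * c i := by
  have h : (c ᵥ* consColumn (Pi.single i 1) A) ᵥ* (consColumn (Pi.single i 1) A).adjugate =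
      signedMinors A i • c := by
    rw [vecMul_vecMul, mul_adjugate, det_consColumn_single, vecMul_smul, vecMul_one]
  have h' := congrFun h j
  rw [vecMul_consColumn, hc, dotProduct_single, mul_one, vecMul, dotProduct,
    Fin.sum_univ_succ] at h'
  simpa [adjugate_consColumn_zero, mul_comm] using h'.symm

/-- The Cramer solution for `[eᵢ | A]` has first coordinate `Δ ⬝ᵥ v = 0`, so it uses only the
columns of `A`. -/
theorem exists_mulVec_eq_signedMinors_smul {A : Matrix (Fin (n + 1)) (Fin n) R}
    {v : Fin (n + 1) → R} (hv : signedMinors A ⬝ᵥ v = 0) (i : Fin (n + 1)) :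
    ∃ w, A *ᵥ w = signedMinors A i • v := by
  refine ⟨Fin.tail ((consColumn (Pi.single i 1) A).adjugate *ᵥ v), ?_⟩
  have h : consColumn (Pi.single i 1) A *ᵥ ((consColumn (Pi.single i 1) A).adjugate *ᵥ v) =
      signedMinors A i • v := by
    rw [mulVec_mulVec, mul_adjugate, det_consColumn_single, smul_mulVec, one_mulVec]
  have h0 : ((consColumn (Pi.single i 1) A).adjugate *ᵥ v) 0 = 0 := by
    rw [mulVec, adjugate_consColumn_zero, hv]
  rwa [consColumn_mulVec, h0, zero_smul, zero_add] at h

theorem exists_vecMul_eq_signedMinors_smul (A : Matrix (Fin (n + 1)) (Fin n) R)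
    (y : Fin n → R) (i : Fin (n + 1)) : ∃ z, z ᵥ* A = signedMinors A i • y := by
  refine ⟨Fin.cons 0 y ᵥ* (consColumn (Pi.single i 1) A).adjugate, ?_⟩
  have h : ((Fin.cons 0 y : Fin (n + 1) → R) ᵥ* (consColumn (Pi.single i 1) A).adjugate) ᵥ*
      consColumn (Pi.single i 1) A = signedMinors A i • Fin.cons 0 y := by
    rw [vecMul_vecMul, adjugate_mul, det_consColumn_single, vecMul_smul, vecMul_one]
  rw [vecMul_consColumn] at h
  ext j
  simpa using congrFun h j.succ

theorem signedMinors_smul_eq_zero_of_mulVec_eq_zero {A : Matrix (Fin (n + 1)) (Fin n) R}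
    {v : Fin n → R} (hv : A *ᵥ v = 0) (i : Fin (n + 1)) : signedMinors A i • v = 0 := by
  have h : consColumn (Pi.single i 1) A *ᵥ Fin.cons 0 v = 0 := by
    rw [consColumn_mulVec]
    simpa using hv
  have h' := congrArg ((consColumn (Pi.single i 1) A).adjugate *ᵥ ·) h
  simp only [mulVec_mulVec, adjugate_mul, det_consColumn_single, smul_mulVec, one_mulVec,
    mulVec_zero] at h'
  ext j
  simpa using congrFun h' j.succ

theorem determinantalIdeal_eq_span_signedMinors (A : Matrix (Fin (n + 1)) (Fin n) R) :
    determinantalIdeal A n = Ideal.span (Set.range (signedMinors A)) := by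
  apply le_antisymm
  · refine Ideal.span_le.2 ?_
    rintro _ ⟨r, c, rfl⟩
    obtain ⟨i, hi⟩ : ∃ i, i ∉ Set.range r := by
      by_contra! h
      have := Fintype.card_le_of_surjective r (fun i => h i)
      simp at this
    have hr : ⇑r = i.succAbove := by
      have hrange : Set.range r = Set.range i.succAbove := by
        rw [Fin.range_succAbove]
        refine Set.eq_of_subset_of_ncard_le (fun x hx => ?_) ?_
        · rintro rfl
          exact hi hx
        · rw [Set.ncard_compl, Set.ncard_singleton, ← Set.image_univ,
            Set.ncard_image_of_injective _ r.injective]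
          simp
      exact (r.strictMono.range_inj (Fin.strictMono_succAbove i)).1 hrange
    have hc : ⇑c = id := by
      refine (c.strictMono.range_inj strictMono_id).1 ?_
      rw [Set.range_id, (Finite.surjective_of_injective c.injective).range_eq]
    rw [hr, hc]
    have : (A.submatrix i.succAbove id).det = (-1) ^ (i : ℕ) * signedMinors A i := by
      rw [signedMinors, ← mul_assoc, ← mul_pow]
      simp
    rw [this]
    exact Ideal.mul_mem_left _ _ (Ideal.subset_span ⟨i, rfl⟩)
  · refine Ideal.span_le.2 ?_
    rintro _ ⟨i, rfl⟩
    exact Ideal.mul_mem_left _ _ (Ideal.subset_span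
      ⟨i.succAboveOrderEmb, RelEmbedding.refl _, rfl⟩)

end SignedMinors

/-! ### McCoy's theorem for matrices. -/

section McCoy

theorem det_dvd_det_submatrix {n : ℕ} (B : Matrix (Fin n) (Fin n) R) (r c : Fin n → Fin n) :
    B.det ∣ (B.submatrix r c).det := by
  have h : B.submatrix r c = (1 : Matrix (Fin n) (Fin n) R).submatrix r id * B *
      (1 : Matrix (Fin n) (Fin n) R).submatrix id c := by
    ext i j
    simp [mul_apply, one_apply]
  rw [h, det_mul, det_mul]
  exact (dvd_mul_left _ _).mul_right _

/-- Add a column `c₀` outside `c`. The vector of `x` times the signed minors on the rows `r` is sent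
by `A` to `x` times minors of order `k + 1`, so it vanishes. Its `c₀`-coordinate is the required
product. Since `r` and `c` are arbitrary functions, repeated rows need no separate case. -/
theorem mul_det_submatrix_eq_zero_of_succ {m p k : ℕ} {A : Matrix (Fin m) (Fin p) R}
    (hA : Function.Injective A.mulVecLin) (hk : k < p) {x : R}
    (hx : ∀ (r : Fin (k + 1) → Fin m) (c : Fin (k + 1) → Fin p), x * (A.submatrix r c).det = 0)
    (r : Fin k → Fin m) (c : Fin k → Fin p) : x * (A.submatrix r c).det = 0 := by
  obtain ⟨c₀, hc₀⟩ : ∃ i, i ∉ Set.range c := by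
    by_contra! h
    have := Fintype.card_le_of_surjective c (fun i => h i)
    simp at this
    omega
  let c' : Fin (k + 1) → Fin p := Fin.cons c₀ c
  let v : Fin p → R := ∑ s : Fin (k + 1), Pi.single (c' s)
    ((-1) ^ (s : ℕ) * (x * (A.submatrix r (c' ∘ s.succAbove)).det))
  have hv : A *ᵥ v = 0 := by
    ext i
    have h := hx (Fin.cons i r) c'
    rw [det_succ_row_zero, Finset.mul_sum] at h
    rw [mulVec_sum, Finset.sum_apply, Pi.zero_apply, ← h]
    refine Finset.sum_congr rfl fun s _ => ?_
    have e : (A.submatrix (Fin.cons i r) c').submatrix Fin.succ s.succAbove =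
        A.submatrix r (c' ∘ s.succAbove) := by
      ext; simp
    rw [e]
    simp
    ring
  have hv0 : v = 0 := hA (by simpa using hv)
  have h := congrFun hv0 c₀
  have e : c' ∘ Fin.succ = c := by ext; simp [c']
  rw [show v = _ from Fin.sum_univ_succ _, Pi.add_apply, Finset.sum_apply,
    Finset.sum_eq_zero (fun s _ => Pi.single_eq_of_ne
      (fun e' => hc₀ ⟨s, by simpa [c'] using e'.symm⟩) _)] at h
  simpa [c', e] using h

/-- McCoy's theorem for matrices with one more row than columns. -/
theorem isCoregular_signedMinors_of_injective {n : ℕ} {A : Matrix (Fin (n + 1)) (Fin n) R}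
    (hA : Function.Injective A.mulVecLin) : IsCoregular (signedMinors A) := by
  intro x hx
  have top : ∀ (r : Fin n → Fin (n + 1)) (c : Fin n → Fin n),
      x * (A.submatrix r c).det = 0 := by
    intro r c
    obtain ⟨i, hi⟩ : ∃ i, i ∉ Set.range r := by
      by_contra! h
      have := Fintype.card_le_of_surjective r (fun i => h i)
      simp at this
    choose r' hr' using fun s => Fin.exists_succAbove_eq (x := r s) (y := i)
      (fun e => hi ⟨s, e⟩)
    have e : A.submatrix r c = (A.submatrix i.succAbove id).submatrix r' c := by
      ext; simp [hr']
    rw [e]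
    obtain ⟨t, ht⟩ := det_dvd_det_submatrix (A.submatrix i.succAbove id) r' c
    have h := congrArg ((-1) ^ (i : ℕ) * ·) (hx i)
    simp only [signedMinors, mul_zero] at h
    rw [mul_left_comm x, ← mul_assoc, ← mul_pow] at h
    rw [ht, ← mul_assoc]
    simp at h
    rw [h, zero_mul]
  have all : ∀ k ≤ n, ∀ (r : Fin k → Fin (n + 1)) (c : Fin k → Fin n),
      x * (A.submatrix r c).det = 0 := by
    intro k hk
    induction hk using Nat.decreasingInduction with
    | self => exact top
    | of_succ k hk ih => exact mul_det_submatrix_eq_zero_of_succ hA hk ih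
  -- The minor of order `0` is `1`.
  simpa using all 0 (Nat.zero_le n) Fin.elim0 Fin.elim0

end McCoy

/-! ### First consequences of exactness. -/

section Exact

variable {n : ℕ} {A : Matrix (Fin (n + 1)) (Fin n) R} {α : Fin (n + 1) → R}

theorem IsExactSeq.exists_mulVec_eq (h : IsExactSeq A α) {v : Fin (n + 1) → R}
    (hv : α ⬝ᵥ v = 0) : ∃ w, A *ᵥ w = v :=
  (h.2 v).1 hv

theorem IsExactSeq.dotProduct_mulVec (h : IsExactSeq A α) (w : Fin n → R) :
    α ⬝ᵥ A *ᵥ w = 0 :=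
  (h.2 (A *ᵥ w)).2 ⟨w, rfl⟩

theorem IsExactSeq.vecMul_eq_zero (h : IsExactSeq A α) : α ᵥ* A = 0 := by
  ext j
  have := h.dotProduct_mulVec (Pi.single j 1)
  rw [Matrix.dotProduct_mulVec] at this
  simpa using this

/-- If `x` kills `α`, exactness gives `A * W = x • 1`, and injectivity of `A` then gives `W * A = x
• 1`. Comparing traces, `(n + 1) x = n x`. -/
theorem IsExactSeq.isCoregular (h : IsExactSeq A α) : IsCoregular α := by
  intro x hx
  choose w hw using fun j => h.exists_mulVec_eq (v := Pi.single j x) (by simp [mul_comm, hx j])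
  let W : Matrix (Fin n) (Fin (n + 1)) R := Matrix.of fun i j => w j i
  have hAW : A * W = x • 1 := by
    ext i j
    have := congrFun (hw j) i
    simpa [mul_apply, W, mulVec, dotProduct, one_apply, Pi.single_apply] using this
  have hWA : W * A = x • 1 := by
    refine ext_of_mulVec_single fun j => h.1 ?_
    simp only [mulVecLin_apply, mulVec_mulVec, ← Matrix.mul_assoc, hAW]
    simp
  have := trace_mul_comm A W
  rw [hAW, hWA, trace_smul, trace_smul, trace_one, trace_one] at this
  simp only [Fintype.card_fin, Nat.cast_add, Nat.cast_one, smul_eq_mul] at this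
  linear_combination this

end Exact

/-! ### Regular sequences of length two and three. -/

section WeaklyRegular

open RingTheory.Sequence

theorem isWeaklyRegular_ofFn_iff {k : ℕ} (f : Fin k → R) :
    IsWeaklyRegular R (List.ofFn f) ↔ ∀ i : Fin k, ∀ x : R,
      f i * x ∈ Ideal.ofList ((List.ofFn f).take i) →
        x ∈ Ideal.ofList ((List.ofFn f).take i) := by
  rw [isWeaklyRegular_iff]
  simp only [isSMulRegular_quotient_iff_mem_of_smul_mem, smul_eq_mul, Ideal.mul_top,
    List.getElem_ofFn, List.length_ofFn, Fin.forall_iff]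

theorem isWeaklyRegular_ofFn_two_iff (f : Fin 2 → R) :
    IsWeaklyRegular R (List.ofFn f) ↔
      f 0 ∈ nonZeroDivisors R ∧ ∀ x, f 0 ∣ f 1 * x → f 0 ∣ x := by
  rw [isWeaklyRegular_ofFn_iff, Fin.forall_fin_two]
  simp [Ideal.mem_span_singleton, mem_nonZeroDivisors_iff_left]

theorem isWeaklyRegular_ofFn_three_iff (f : Fin 3 → R) :
    IsWeaklyRegular R (List.ofFn f) ↔
      f 0 ∈ nonZeroDivisors R ∧ (∀ x, f 0 ∣ f 1 * x → f 0 ∣ x) ∧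
        ∀ x, f 2 * x ∈ Ideal.span {f 0, f 1} → x ∈ Ideal.span {f 0, f 1} := by
  rw [isWeaklyRegular_ofFn_iff, Fin.forall_fin_succ, Fin.forall_fin_two]
  simp [Ideal.ofList_cons, Ideal.mem_span_singleton,
    mem_nonZeroDivisors_iff_left, Ideal.span_insert]

/-- A family proportional to a family whose ideal contains a regular sequence of length two is a
multiple of that family. -/
theorem exists_smul_eq_of_mul_comm {ι : Type*} [Finite ι] {d w : ι → R} {f₁ f₂ : R}
    (hf₁ : f₁ ∈ Ideal.span (Set.range d)) (hf₂ : f₂ ∈ Ideal.span (Set.range d))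
    (h₁ : f₁ ∈ nonZeroDivisors R) (h₂ : ∀ x, f₁ ∣ f₂ * x → f₁ ∣ x)
    (h : ∀ i j, d i * w j = d j * w i) : ∃ c : R, w = c • d := by
  have := Fintype.ofFinite ι
  obtain ⟨p, rfl⟩ := Ideal.mem_span_range_iff_exists_fun.1 hf₁
  obtain ⟨q, rfl⟩ := Ideal.mem_span_range_iff_exists_fun.1 hf₂
  have key : ∀ (r : ι → R) (i : ι), (∑ j, r j * d j) * w i = (∑ j, r j * w j) * d i := by
    intro r i
    rw [Finset.sum_mul, Finset.sum_mul]
    exact Finset.sum_congr rfl fun j _ => by linear_combination r j * h j i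
  -- With `f₁ = ∑ p d` and `f₂ = ∑ q d`, proportionality gives `f₂ ∑ p w = f₁ ∑ q w`; the scalar is
  -- `∑ p w` divided by `f₁`.
  obtain ⟨c, hc⟩ := h₂ (∑ j, p j * w j) ⟨∑ j, q j * w j, by
    rw [mul_comm, Finset.mul_sum, Finset.mul_sum]
    refine Finset.sum_congr rfl fun j _ => ?_
    linear_combination -q j * key p j⟩
  refine ⟨c, funext fun i => ?_⟩
  refine (mul_cancel_left_mem_nonZeroDivisors h₁).1 ?_
  rw [key, hc, Pi.smul_apply, smul_eq_mul, mul_assoc]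

end WeaklyRegular

/-! ### Content ideals and descent from polynomials. -/

section Content

variable {σ : Type*}

theorem mem_span_C_of_contentIdeal_eq {ι : Type*} {d : ι → R} {f : MvPolynomial σ R}
    (hf : contentIdeal f = Ideal.span (Set.range d)) :
    f ∈ Ideal.span (Set.range fun i => (MvPolynomial.C (d i) : MvPolynomial σ R)) := by
  have h : f ∈ Ideal.map MvPolynomial.C (Ideal.span (Set.range d)) := by
    rw [MvPolynomial.mem_map_C_iff, ← hf]
    exact fun m => Ideal.subset_span ⟨m, rfl⟩
  rwa [Ideal.map_span, ← Set.range_comp] at h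

theorem isCoregular_of_mem_span {ι : Type*} {d : ι → R} {f : R}
    (hf : f ∈ Ideal.span (Set.range d)) (h : f ∈ nonZeroDivisors R) : IsCoregular d := by
  intro x hx
  have : ∀ y ∈ Ideal.span (Set.range d), x * y = 0 := by
    intro y hy
    induction hy using Submodule.span_induction with
    | mem y hy => obtain ⟨i, rfl⟩ := hy; exact hx i
    | zero => exact mul_zero x
    | add y z _ _ hy hz => rw [mul_add, hy, hz, add_zero]
    | smul a y _ hy => rw [smul_eq_mul, mul_left_comm, hy, mul_zero]
  exact (mem_nonZeroDivisors_iff_right.1 h) x (this f hf)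

theorem eq_of_C_smul_C {ι : Type*} {d w : ι → R} {c : MvPolynomial σ R}
    (h : (fun i => MvPolynomial.C (w i)) = c • fun i => (MvPolynomial.C (d i) : MvPolynomial σ R)) :
    w = c.constantCoeff • d := by
  ext i
  simpa using congrArg MvPolynomial.constantCoeff (congrFun h i)

end Content

/-! ### Consequences of depth two. -/

section DepthTwo

variable {ι : Type*} {d : ι → R}

theorem isCoregular_of_C {σ : Type*}
    (h : IsCoregular fun i => (MvPolynomial.C (d i) : MvPolynomial σ R)) : IsCoregular d := by
  intro x hx
  have := h (MvPolynomial.C x) fun i => by rw [← map_mul, hx, map_zero]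
  simpa using this

theorem DepthGE.isCoregular (h : DepthGE (Ideal.span (Set.range d)) 2) : IsCoregular d := by
  obtain ⟨f, hf, hr⟩ := h
  rw [isWeaklyRegular_ofFn_two_iff] at hr
  exact isCoregular_of_C (isCoregular_of_mem_span
    (mem_span_C_of_contentIdeal_eq (hf.content_eq 0)) hr.1)

theorem DepthGE.exists_smul_eq [Finite ι] (h : DepthGE (Ideal.span (Set.range d)) 2) {w : ι → R}
    (hw : ∀ i j, d i * w j = d j * w i) : ∃ c : R, w = c • d := by
  obtain ⟨f, hf, hr⟩ := h
  rw [isWeaklyRegular_ofFn_two_iff] at hr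
  obtain ⟨c, hc⟩ := exists_smul_eq_of_mul_comm (w := fun i => MvPolynomial.C (w i))
    (mem_span_C_of_contentIdeal_eq (hf.content_eq 0))
    (mem_span_C_of_contentIdeal_eq (hf.content_eq 1)) hr.1 hr.2
    fun i j => by rw [← map_mul, ← map_mul, hw]
  exact ⟨_, eq_of_C_smul_C hc⟩

end DepthTwo

/-! ### Kronecker polynomials and a criterion for depth two. -/

section KroneckerPolynomial

open MvPolynomial

variable {m : ℕ}

/-- The Kronecker polynomial `∑ d i * X ^ i` in the variable with index `k`. -/
noncomputable def kroneckerPoly (d : Fin m → R) (k : ℕ) : MvPolynomial ℕ R :=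
  ∑ i, C (d i) * X k ^ (i : ℕ)

theorem contentIdeal_kroneckerPoly (d : Fin m → R) (k : ℕ) :
    contentIdeal (kroneckerPoly d k) = Ideal.span (Set.range d) := by
  have hc : ∀ e : ℕ →₀ ℕ, coeff e (kroneckerPoly d k) =
      ∑ i : Fin m, if Finsupp.single k (i : ℕ) = e then d i else 0 := by
    intro e
    simp only [kroneckerPoly, coeff_sum, coeff_C_mul, coeff_X_pow, mul_ite, mul_one, mul_zero]
  apply le_antisymm
  · refine Ideal.span_le.2 ?_
    rintro _ ⟨e, rfl⟩
    simp only [hc]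
    refine Ideal.sum_mem _ fun i _ => ?_
    split_ifs
    · exact Ideal.subset_span ⟨i, rfl⟩
    · exact Ideal.zero_mem _
  · refine Ideal.span_le.2 ?_
    rintro _ ⟨i, rfl⟩
    refine Ideal.subset_span ⟨Finsupp.single k i, ?_⟩
    simp only [hc]
    rw [Finset.sum_eq_single i (fun j _ hj => if_neg fun e => hj ?_) (by simp), if_pos rfl]
    exact Fin.ext (Finsupp.single_injective k e)

theorem vars_kroneckerPoly_subset (d : Fin m → R) (k : ℕ) :
    ((kroneckerPoly d k).vars : Set ℕ) ⊆ {k} := by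
  rw [← mem_supported (R := R)]
  refine Subalgebra.sum_mem _ fun i _ => Subalgebra.mul_mem _ (Subalgebra.algebraMap_mem _ _)
    (Subalgebra.pow_mem _ ?_ _)
  exact Algebra.subset_adjoin ⟨k, rfl, rfl⟩

theorem isKroneckerSeq_kroneckerPoly (d : Fin m → R) {l : ℕ} {k : Fin l → ℕ}
    (hk : Function.Injective k) :
    IsKroneckerSeq (Ideal.span (Set.range d)) fun j => kroneckerPoly d (k j) where
  content_eq _ := contentIdeal_kroneckerPoly d _
  disjoint_vars i j hij := by
    rw [← Finset.disjoint_coe]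
    exact Set.disjoint_of_subset (vars_kroneckerPoly_subset d _) (vars_kroneckerPoly_subset d _)
      (by simpa using fun e => hij (hk e))

/-- Polynomials in countably many variables as polynomials in the first variable. -/
noncomputable def firstVarEquiv : MvPolynomial ℕ R ≃ₐ[R] Polynomial (MvPolynomial ℕ R) :=
  (renameEquiv R (⟨fun k => Nat.casesOn k none some, fun o => o.elim 0 Nat.succ,
    fun k => by cases k <;> rfl, fun o => by cases o <;> rfl⟩ : ℕ ≃ Option ℕ)).trans
    (optionEquivLeft R ℕ)

theorem firstVarEquiv_kroneckerPoly_zero (d : Fin m → R) :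
    firstVarEquiv (kroneckerPoly d 0) =
      ∑ i, Polynomial.C (C (d i)) * (Polynomial.X : Polynomial (MvPolynomial ℕ R)) ^ (i : ℕ) := by
  simp [firstVarEquiv, kroneckerPoly]

theorem firstVarEquiv_kroneckerPoly_one (d : Fin m → R) :
    firstVarEquiv (kroneckerPoly d 1) = Polynomial.C (kroneckerPoly d 0) := by
  simp [firstVarEquiv, kroneckerPoly]

/-- McCoy's theorem for polynomials, modulo an element of the base ring. -/
theorem C_dvd_of_C_dvd_sum_mul {d : Fin m → R} {g : R}
    (hd : ∀ x, (∀ i, g ∣ x * d i) → g ∣ x) (p : Polynomial R)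
    (hp : Polynomial.C g ∣ (∑ i, Polynomial.C (d i) * Polynomial.X ^ (i : ℕ)) * p) :
    Polynomial.C g ∣ p := by
  let π := Ideal.Quotient.mk (Ideal.span {g})
  have hπ : ∀ x, π x = 0 ↔ g ∣ x := fun x => by
    rw [Ideal.Quotient.eq_zero_iff_mem, Ideal.mem_span_singleton]
  have hmap : ∀ q : Polynomial R, Polynomial.C g ∣ q ↔ q.map π = 0 := by
    intro q
    simp [Polynomial.C_dvd_iff_dvd_coeff, Polynomial.ext_iff, hπ]
  rw [hmap, Polynomial.map_mul] at hp
  rw [hmap]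
  refine (mem_nonZeroDivisors_iff_left.1 (Polynomial.mem_nonZeroDivisors_iff.2 ?_)) _ hp
  intro a ha
  obtain ⟨x, rfl⟩ := Ideal.Quotient.mk_surjective a
  refine (hπ x).2 (hd x fun i => (hπ _).1 ?_)
  have := congrArg (Polynomial.coeff · i) ha
  simp only [Polynomial.coeff_smul, Polynomial.coeff_map, Polynomial.finsetSum_coeff,
    Polynomial.coeff_C_mul, Polynomial.coeff_X_pow, mul_ite, mul_one, mul_zero,
    Polynomial.coeff_zero, smul_eq_mul] at this
  rw [Finset.sum_eq_single i (fun j _ hj => if_neg fun e => hj (Fin.ext e.symm)) (by simp),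
    if_pos rfl] at this
  rw [map_mul]
  exact this

theorem dvd_of_dvd_kroneckerPoly_mul {d : Fin m → R} {g : MvPolynomial ℕ R}
    (hd : ∀ x, (∀ i, g ∣ x * C (d i)) → g ∣ x) {f x : MvPolynomial ℕ R}
    (hf : firstVarEquiv f = Polynomial.C g) (hx : f ∣ kroneckerPoly d 0 * x) : f ∣ x := by
  have h := map_dvd (firstVarEquiv (R := R)) hx
  rw [map_mul, hf, firstVarEquiv_kroneckerPoly_zero] at h
  have h' := C_dvd_of_C_dvd_sum_mul hd _ h
  rwa [← hf, map_dvd_iff] at h'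

theorem IsCoregular.map_C {ι σ : Type*} {d : ι → R} (hd : IsCoregular d) :
    IsCoregular fun i => (MvPolynomial.C (d i) : MvPolynomial σ R) := by
  intro x hx
  ext e
  refine hd _ fun i => ?_
  rw [mul_comm, ← coeff_C_mul, mul_comm, hx, coeff_zero]

theorem IsCoregular.kroneckerPoly_zero_mem {d : Fin m → R} (hd : IsCoregular d) :
    kroneckerPoly d 0 ∈ nonZeroDivisors (MvPolynomial ℕ R) := by
  refine mem_nonZeroDivisors_iff_left.2 fun x hx => ?_
  -- With `g = f = 0`, divisibility means vanishing.
  refine zero_dvd_iff.1 (dvd_of_dvd_kroneckerPoly_mul (d := d) (g := 0) (f := 0) ?_ ?_ ?_)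
  · simp only [zero_dvd_iff]
    exact hd.map_C
  · simp
  · rw [hx]

theorem IsCoregular.kroneckerPoly_one_mem {d : Fin m → R} (hd : IsCoregular d) :
    kroneckerPoly d 1 ∈ nonZeroDivisors (MvPolynomial ℕ R) := by
  refine mem_nonZeroDivisors_iff_left.2 fun x hx => ?_
  have h := congrArg (firstVarEquiv (R := R)) hx
  rw [map_mul, firstVarEquiv_kroneckerPoly_one, map_zero] at h
  rw [← map_eq_zero_iff _ (firstVarEquiv (R := R)).injective]
  ext1 e
  refine mem_nonZeroDivisors_iff_left.1 hd.kroneckerPoly_zero_mem _ ?_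
  simpa using congrArg (Polynomial.coeff · e) h

/-- The criterion by which depth at least two is established. -/
theorem depthGE_two_of_kroneckerPoly {d : Fin m → R} (hd : IsCoregular d)
    (h : ∀ x : MvPolynomial ℕ R,
      (∀ i, kroneckerPoly d 0 ∣ x * MvPolynomial.C (d i)) → kroneckerPoly d 0 ∣ x) :
    DepthGE (Ideal.span (Set.range d)) 2 := by
  -- Variable `1` comes first: once variable `0` is split off, the first polynomial is a constant,
  -- and reindexing makes it `kroneckerPoly d 0` again.
  refine ⟨_, isKroneckerSeq_kroneckerPoly d (k := ![1, 0]) ?_, ?_⟩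
  · intro i j
    fin_cases i <;> fin_cases j <;> simp
  · rw [isWeaklyRegular_ofFn_two_iff]
    exact ⟨hd.kroneckerPoly_one_mem,
      fun x => dvd_of_dvd_kroneckerPoly_mul h (firstVarEquiv_kroneckerPoly_one d)⟩

end KroneckerPolynomial

/-! ### Exactness is equivalent to depth two. -/

section ExactDepth

variable {n : ℕ} {A : Matrix (Fin (n + 1)) (Fin n) R} {α : Fin (n + 1) → R}

theorem coeff_map_C_mulVec {σ : Type*} {m p : ℕ} (A : Matrix (Fin m) (Fin p) R)
    (w : Fin p → MvPolynomial σ R) (e : σ →₀ ℕ) (i : Fin m) :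
    MvPolynomial.coeff e ((A.map MvPolynomial.C *ᵥ w) i) =
      (A *ᵥ fun j => MvPolynomial.coeff e (w j)) i := by
  simp [mulVec, dotProduct, MvPolynomial.coeff_sum, MvPolynomial.coeff_C_mul]

/-- The matrices are constant, so everything is checked one monomial at a time; finitely many
monomials occur in `v`, so the preimages of its coefficients add up to a polynomial vector. -/
theorem IsExactSeq.map_C {σ : Type*} (h : IsExactSeq A α) :
    IsExactSeq (A.map (MvPolynomial.C : R →+* MvPolynomial σ R))
      fun i => MvPolynomial.C (α i) := by
  classical
  refine ⟨(injective_iff_map_eq_zero _).2 fun w hw => ?_, fun v => ⟨fun hv => ?_, ?_⟩⟩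
  · ext j e
    have : A *ᵥ (fun j => MvPolynomial.coeff e (w j)) = 0 := by
      ext i
      rw [← coeff_map_C_mulVec]
      simpa using congrArg (MvPolynomial.coeff e) (congrFun hw i)
    have h0 := h.1 (a₁ := fun j => MvPolynomial.coeff e (w j)) (a₂ := 0) (by simpa using this)
    simpa using congrFun h0 j
  · choose z hz using fun e : σ →₀ ℕ => h.exists_mulVec_eq
      (v := fun i => MvPolynomial.coeff e (v i)) (by
        have := congrArg (MvPolynomial.coeff e) (show _ ⬝ᵥ v = 0 from hv)
        simpa [dotProduct, MvPolynomial.coeff_sum, MvPolynomial.coeff_C_mul] using this)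
    let F := Finset.univ.biUnion fun i => (v i).support
    refine ⟨fun j => ∑ e ∈ F, MvPolynomial.monomial e (z e j), ?_⟩
    ext i e
    rw [mulVecLin_apply, coeff_map_C_mulVec]
    have hc : (fun j => MvPolynomial.coeff e (∑ e ∈ F, MvPolynomial.monomial e (z e j))) =
        if e ∈ F then z e else 0 := by
      ext j
      simp only [MvPolynomial.coeff_sum, MvPolynomial.coeff_monomial, Finset.sum_ite_eq']
      split_ifs <;> rfl
    rw [hc]
    split_ifs with he
    · rw [hz]
    · have : e ∉ (v i).support := fun h' => he (Finset.mem_biUnion.2 ⟨i, Finset.mem_univ _, h'⟩)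
      rw [mulVec_zero, MvPolynomial.notMem_support_iff.1 this, Pi.zero_apply]
  · rintro ⟨w, rfl⟩
    change (fun i => MvPolynomial.C (α i)) ⬝ᵥ (A.map MvPolynomial.C *ᵥ w) = 0
    have hα : (fun i => (MvPolynomial.C (α i) : MvPolynomial σ R)) ᵥ*
        A.map MvPolynomial.C = 0 := by
      ext1 j
      have := congrArg (MvPolynomial.C (σ := σ)) (congrFun h.vecMul_eq_zero j)
      simpa [vecMul, dotProduct] using this
    rw [Matrix.dotProduct_mulVec, hα, zero_dotProduct]

/-- `A` is injective modulo `g`: if `A v = g w`, then `g (α ⬝ᵥ w) = 0`, so `w = A z` and `v = g z`.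
McCoy's theorem over the quotient concludes. -/
theorem IsExactSeq.dvd_of_dvd_mul_signedMinors (h : IsExactSeq A α) {g : R}
    (hg : g ∈ nonZeroDivisors R) {x : R} (hx : ∀ i, g ∣ x * signedMinors A i) : g ∣ x := by
  let π := Ideal.Quotient.mk (Ideal.span {g})
  have hπ : ∀ x, π x = 0 ↔ g ∣ x := fun x => by
    rw [Ideal.Quotient.eq_zero_iff_mem, Ideal.mem_span_singleton]
  have hinj : Function.Injective (A.map π).mulVecLin := by
    refine (injective_iff_map_eq_zero _).2 fun v' hv' => ?_
    choose v hv using fun j => Ideal.Quotient.mk_surjective (v' j)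
    obtain rfl : (fun j => π (v j)) = v' := funext hv
    have hdvd : ∀ i, g ∣ (A *ᵥ v) i := by
      intro i
      rw [← hπ]
      simpa [mulVec, dotProduct] using congrFun hv' i
    choose w hw using hdvd
    have hAv : A *ᵥ v = g • w := funext hw
    obtain ⟨z, rfl⟩ := h.exists_mulVec_eq (v := w) (by
      refine mem_nonZeroDivisors_iff_left.1 hg _ ?_
      rw [← smul_eq_mul, ← dotProduct_smul, ← hAv, h.dotProduct_mulVec])
    have hvz : v = g • z := h.1 (by simpa using hAv)
    ext j
    rw [Pi.zero_apply, hπ, hvz]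
    exact dvd_mul_right _ _
  refine (hπ x).1 (isCoregular_signedMinors_of_injective hinj _ fun i => ?_)
  rw [signedMinors_map, ← map_mul, hπ]
  exact hx i

theorem IsExactSeq.depthGE_two (h : IsExactSeq A α) :
    DepthGE (Ideal.span (Set.range (signedMinors A))) 2 := by
  have hd := isCoregular_signedMinors_of_injective h.1
  refine depthGE_two_of_kroneckerPoly hd fun x hx =>
    h.map_C.dvd_of_dvd_mul_signedMinors hd.kroneckerPoly_zero_mem fun i => ?_
  rw [signedMinors_map]
  exact hx i

theorem rowMap_signedMinors_comp (A : Matrix (Fin (n + 1)) (Fin n) R) :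
    rowMap (signedMinors A) ∘ₗ A.mulVecLin = 0 := by
  refine LinearMap.ext fun w => ?_
  change signedMinors A ⬝ᵥ A *ᵥ w = 0
  rw [Matrix.dotProduct_mulVec, signedMinors_vecMul, zero_dotProduct]

theorem injective_of_isCoregular_signedMinors (hd : IsCoregular (signedMinors A)) :
    Function.Injective A.mulVecLin := by
  refine (injective_iff_map_eq_zero _).2 fun v hv => funext fun j => hd _ fun i => ?_
  rw [mul_comm]
  exact congrFun (signedMinors_smul_eq_zero_of_mulVec_eq_zero hv i) j

/-- For `Δ ⬝ᵥ v = 0`, Cramer gives `A wᵢ = Δᵢ v`. Injectivity yields `Δᵢ wⱼ = Δⱼ wᵢ`, so depth two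
gives `wᵢ = Δᵢ c`, and faithfulness of `Δ` gives `A c = v`. -/
theorem isExactSeq_signedMinors
    (h : DepthGE (Ideal.span (Set.range (signedMinors A))) 2) :
    IsExactSeq A (signedMinors A) := by
  have hd := h.isCoregular
  have hinj := injective_of_isCoregular_signedMinors hd
  refine ⟨hinj, fun v => ⟨fun hv => ?_, ?_⟩⟩
  · choose w hw using exists_mulVec_eq_signedMinors_smul (A := A) (v := v) hv
    have hcomm : ∀ i j, signedMinors A i • w j = signedMinors A j • w i := by
      intro i j
      refine hinj ?_
      simp only [mulVecLin_apply, mulVec_smul, hw]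
      exact smul_comm _ _ _
    choose c hc using fun k => h.exists_smul_eq (w := fun i => w i k)
      fun i j => congrFun (hcomm i j) k
    refine ⟨c, ?_⟩
    ext l
    refine sub_eq_zero.1 (hd _ fun i => ?_)
    have hwi : w i = signedMinors A i • c := by
      ext k
      rw [show w i k = _ from congrFun (hc k) i]
      simp [mul_comm]
    have := congrFun (hw i) l
    rw [hwi, mulVec_smul] at this
    simp only [Pi.smul_apply, smul_eq_mul] at this
    rw [mulVecLin_apply]
    linear_combination this
  · rintro ⟨w, rfl⟩
    exact LinearMap.congr_fun (rowMap_signedMinors_comp A) w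

end ExactDepth

/-! ### Depth three forces the unit ideal. -/

section DepthThree

variable {n : ℕ} {A : Matrix (Fin (n + 1)) (Fin n) R}

theorem exists_vecMul_eq_smul_of_mem_span {f : R}
    (hf : f ∈ Ideal.span (Set.range (signedMinors A))) (y : Fin n → R) :
    ∃ z, z ᵥ* A = f • y := by
  induction hf using Submodule.span_induction with
  | mem f hf =>
    obtain ⟨i, rfl⟩ := hf
    exact exists_vecMul_eq_signedMinors_smul A y i
  | zero => exact ⟨0, by simp⟩
  | add f g _ _ hf hg =>
    obtain ⟨z, hz⟩ := hf
    obtain ⟨z', hz'⟩ := hg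
    exact ⟨z + z', by rw [add_vecMul, hz, hz', add_smul]⟩
  | smul a f _ hf =>
    obtain ⟨z, hz⟩ := hf
    exact ⟨a • z, by rw [smul_vecMul, hz, smul_assoc]⟩

/-- A Koszul argument. Solve `zₖ A = fₖ y`; then `f₂ z₁ - f₁ z₂ = c₁₂ Δ`, and cyclically. The cycle
relation and regularity of `f₃` put `c₁₂ = b₁ f₁ + b₂ f₂`, so `f₂ (z₁ - b₂ Δ) = f₁ (z₂ + b₁ Δ)`.
Hence `f₁` divides `z₁ - b₂ Δ`, and the quotient solves the system. -/
theorem exists_vecMul_eq_of_regular {f₁ f₂ f₃ : R}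
    (hf₁ : f₁ ∈ Ideal.span (Set.range (signedMinors A)))
    (hf₂ : f₂ ∈ Ideal.span (Set.range (signedMinors A)))
    (hf₃ : f₃ ∈ Ideal.span (Set.range (signedMinors A)))
    (h₁ : f₁ ∈ nonZeroDivisors R) (h₂ : ∀ x, f₁ ∣ f₂ * x → f₁ ∣ x)
    (h₃ : ∀ x, f₃ * x ∈ Ideal.span {f₁, f₂} → x ∈ Ideal.span {f₁, f₂}) (y : Fin n → R) :
    ∃ z, z ᵥ* A = y := by
  have hd := isCoregular_of_mem_span hf₁ h₁
  obtain ⟨z₁, hz₁⟩ := exists_vecMul_eq_smul_of_mem_span hf₁ y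
  obtain ⟨z₂, hz₂⟩ := exists_vecMul_eq_smul_of_mem_span hf₂ y
  obtain ⟨z₃, hz₃⟩ := exists_vecMul_eq_smul_of_mem_span hf₃ y
  have key : ∀ {f g : R} {z z' : Fin (n + 1) → R}, z ᵥ* A = f • y → z' ᵥ* A = g • y →
      ∃ c, ∀ i, g * z i - f * z' i = c * signedMinors A i := by
    intro f g z z' hz hz'
    obtain ⟨c, hc⟩ := exists_smul_eq_of_mul_comm hf₁ hf₂ h₁ h₂
      (mul_signedMinors_comm_of_vecMul_eq_zero (A := A) (c := g • z - f • z') (by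
        rw [sub_vecMul, smul_vecMul, smul_vecMul, hz, hz', smul_comm, sub_self]))
    exact ⟨c, fun i => congrFun hc i⟩
  obtain ⟨c₁₂, h₁₂⟩ := key hz₁ hz₂
  obtain ⟨c₂₃, h₂₃⟩ := key hz₂ hz₃
  obtain ⟨c₃₁, h₃₁⟩ := key hz₃ hz₁
  have hcycle : f₃ * c₁₂ + f₁ * c₂₃ + f₂ * c₃₁ = 0 := hd _ fun i => by
    linear_combination -f₃ * h₁₂ i - f₁ * h₂₃ i - f₂ * h₃₁ i
  obtain ⟨b₁, b₂, hb⟩ := Ideal.mem_span_pair.1 (h₃ c₁₂ (Ideal.mem_span_pair.2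
    ⟨-c₂₃, -c₃₁, by linear_combination -hcycle⟩))
  have hdvd : ∀ i, f₁ ∣ z₁ i - b₂ * signedMinors A i := fun i => h₂ _
    ⟨z₂ i + b₁ * signedMinors A i, by linear_combination h₁₂ i - signedMinors A i * hb⟩
  choose z hz using hdvd
  refine ⟨z, ?_⟩
  have hfz : f₁ • z = z₁ - b₂ • signedMinors A := funext fun i => (hz i).symm
  have hA : f₁ • z ᵥ* A = f₁ • y := by
    rw [← smul_vecMul, hfz, sub_vecMul, smul_vecMul, signedMinors_vecMul, smul_zero, sub_zero,
      hz₁]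
  ext j
  exact (mul_cancel_left_mem_nonZeroDivisors h₁).1 (congrFun hA j)

/-- Modulo the ideal of `Δ`, the left inverse keeps `A` injective, while all `Δᵢ` vanish; McCoy's
theorem forces `1 = 0` there. -/
theorem one_mem_span_signedMinors_of_mul_eq_one {B : Matrix (Fin n) (Fin (n + 1)) R}
    (h : B * A = 1) : (1 : R) ∈ Ideal.span (Set.range (signedMinors A)) := by
  let π := Ideal.Quotient.mk (Ideal.span (Set.range (signedMinors A)))
  have hBA : B.map π * A.map π = 1 := by
    rw [← Matrix.map_mul, h, Matrix.map_one _ π.map_zero π.map_one]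
  have hinj : Function.Injective (A.map π).mulVecLin :=
    Function.LeftInverse.injective (g := (B.map π).mulVecLin) fun v => by
      simp only [mulVecLin_apply, mulVec_mulVec, hBA, one_mulVec]
  refine Ideal.Quotient.eq_zero_iff_mem.1
    (isCoregular_signedMinors_of_injective hinj _ fun i => ?_)
  rw [signedMinors_map, Ideal.Quotient.eq_zero_iff_mem.2 (Ideal.subset_span (Set.mem_range_self i)),
    mul_zero]

theorem one_mem_span_signedMinors_of_depthGE_three
    (h : DepthGE (Ideal.span (Set.range (signedMinors A))) 3) :
    (1 : R) ∈ Ideal.span (Set.range (signedMinors A)) := by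
  obtain ⟨f, hf, hr⟩ := h
  rw [isWeaklyRegular_ofFn_three_iff] at hr
  have hmem : ∀ i, f i ∈ Ideal.span (Set.range (signedMinors (A.map MvPolynomial.C))) := by
    intro i
    rw [show signedMinors (A.map MvPolynomial.C) = _ from
      funext (signedMinors_map (MvPolynomial.C : R →+* MvPolynomial ℕ R) A)]
    exact mem_span_C_of_contentIdeal_eq (hf.content_eq i)
  choose z hz using fun k => exists_vecMul_eq_of_regular (hmem 0) (hmem 1) (hmem 2)
    hr.1 hr.2.1 hr.2.2 (Pi.single k 1)
  -- The rows `z k` form a left inverse over the polynomial ring; their constant terms form one over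
  -- `R`.
  refine one_mem_span_signedMinors_of_mul_eq_one
    (B := Matrix.of fun k i => (z k i).constantCoeff) ?_
  ext k j
  have := congrArg MvPolynomial.constantCoeff (congrFun (hz k) j)
  simpa [mul_apply, vecMul, dotProduct, one_apply, Pi.single_apply, eq_comm, apply_ite]
    using this

end DepthThree

/-! ### Strong gcds and the Hilbert–Burch factor. -/

section StrongGcd

theorem IsStrongGcd.of_span_eq {ι κ : Type*} {a : ι → R} {b : κ → R} {g : R}
    (h : IsStrongGcd a g) (hab : Ideal.span (Set.range b) = Ideal.span (Set.range a)) :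
    IsStrongGcd b g := by
  have key : ∀ x y : R, (∀ k, y ∣ x * b k) → ∀ i, y ∣ x * a i := by
    intro x y hb i
    have hle : Ideal.span (Set.range b) ≤
        Submodule.comap (LinearMap.mulLeft R x) (Ideal.span {y}) := by
      refine Ideal.span_le.2 ?_
      rintro _ ⟨k, rfl⟩
      exact Ideal.mem_span_singleton.2 (hb k)
    exact Ideal.mem_span_singleton.1 (hle (hab ▸ Ideal.subset_span (Set.mem_range_self i)))
  refine ⟨fun x hx => h.coregular x fun i => ?_, fun k => ?_, fun y hy x hx =>
    h.dvd_of_dvd y hy x (key x y hx)⟩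
  -- Coregularity is the case `y = 0` of `key`.
  · exact zero_dvd_iff.1 (key x 0 (fun k => by rw [hx]) i)
  · have hle : Ideal.span (Set.range a) ≤ Ideal.span {g} := by
      refine Ideal.span_le.2 ?_
      rintro _ ⟨i, rfl⟩
      exact Ideal.mem_span_singleton.2 (h.dvd i)
    exact Ideal.mem_span_singleton.1 (hle (hab ▸ Ideal.subset_span (Set.mem_range_self k)))

/-- If `x a dᵢ = y cᵢ` with `y` regular, then `c` is proportional to `d`, so depth two gives `c = t
d`, and faithfulness of `d` gives `x a = y t`. -/
theorem IsStrongGcd.of_smul {m : ℕ} {d : Fin m → R} {a : R}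
    (hd : DepthGE (Ideal.span (Set.range d)) 2) (ha : a ∈ nonZeroDivisors R) :
    IsStrongGcd (a • d) a := by
  refine ⟨fun x hx => ?_, fun i => dvd_mul_right _ _, fun y hy x hx => ?_⟩
  · refine mem_nonZeroDivisors_iff_right.1 ha _ (hd.isCoregular _ fun i => ?_)
    rw [mul_assoc]
    exact hx i
  · choose c hc using hx
    simp only [Pi.smul_apply, smul_eq_mul] at hc
    obtain ⟨t, rfl⟩ := hd.exists_smul_eq (w := c) fun i j => by
      refine (mul_cancel_left_mem_nonZeroDivisors hy).1 ?_
      linear_combination d j * hc i - d i * hc j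
    refine ⟨t, sub_eq_zero.1 (hd.isCoregular _ fun i => ?_)⟩
    have := hc i
    rw [Pi.smul_apply, smul_eq_mul] at this
    linear_combination this

theorem isPrincipal_span_smul {ι : Type*} [Fintype ι] {d : ι → R} (a : R)
    (hd : (1 : R) ∈ Ideal.span (Set.range d)) :
    (Ideal.span (Set.range (a • d))).IsPrincipal := by
  refine ⟨a, le_antisymm (Ideal.span_le.2 ?_) (Ideal.span_le.2 ?_)⟩
  · rintro _ ⟨i, rfl⟩
    exact Ideal.mem_span_singleton.2 (dvd_mul_right _ _)
  · obtain ⟨p, hp⟩ := Ideal.mem_span_range_iff_exists_fun.1 hd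
    refine Set.singleton_subset_iff.2 (Ideal.mem_span_range_iff_exists_fun.2 ⟨p, ?_⟩)
    simp only [Pi.smul_apply, smul_eq_mul, mul_left_comm _ a, ← Finset.mul_sum, hp, mul_one]

end StrongGcd

/-- `α` kills `A`, so it is proportional to `Δ`, and depth two supplies the factor; whatever kills
the factor kills `α`, which is faithful. -/
theorem IsExactSeq.exists_eq_smul_signedMinors {n : ℕ} {A : Matrix (Fin (n + 1)) (Fin n) R}
    {α : Fin (n + 1) → R} (h : IsExactSeq A α) :
    ∃ a ∈ nonZeroDivisors R, α = a • signedMinors A := by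
  obtain ⟨a, ha⟩ := h.depthGE_two.exists_smul_eq
    (mul_signedMinors_comm_of_vecMul_eq_zero h.vecMul_eq_zero)
  refine ⟨a, mem_nonZeroDivisors_iff_right.2 fun x hx => h.isCoregular x fun i => ?_, ha⟩
  rw [ha, Pi.smul_apply, smul_eq_mul, ← mul_assoc, hx, zero_mul]

end HilbertBurch

open HilbertBurch
theorem mainTheorem4 {R : Type*} [CommRing R] (n : ℕ) (A : Matrix (Fin (n + 1)) (Fin n) R) :
    -- the ideal of maximal minors is generated by the signed minors
    determinantalIdeal A n = Ideal.span (Set.range (signedMinors A)) ∧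
    -- `0 → Rⁿ → Rⁿ⁺¹ → R` with the maps `A` and `Δ` is a complex
    rowMap (signedMinors A) ∘ₗ A.mulVecLin = 0 ∧
    -- it is exact iff the depth of the ideal of minors is at least two
    (IsExactSeq A (signedMinors A) ↔
      DepthGE (Ideal.span (Set.range (signedMinors A))) 2) ∧
    -- depth at least three forces the unit ideal
    (DepthGE (Ideal.span (Set.range (signedMinors A))) 3 →
      (1 : R) ∈ Ideal.span (Set.range (signedMinors A))) ∧
    -- the theorem of Hilbert and Burch
    ∀ α : Fin (n + 1) → R, IsExactSeq A α →
      (∃ a : R, (a ∈ nonZeroDivisors R ∧ α = a • signedMinors A) ∧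
        (∀ b : R, b ∈ nonZeroDivisors R ∧ α = b • signedMinors A → b = a) ∧
        IsStrongGcd α a ∧ IsStrongGcdOfIdeal (Ideal.span (Set.range α)) a) ∧
      DepthGE (Ideal.span (Set.range (signedMinors A))) 2 ∧
      (DepthGE (Ideal.span (Set.range (signedMinors A))) 3 →
        (1 : R) ∈ Ideal.span (Set.range (signedMinors A)) ∧
        (Ideal.span (Set.range α)).IsPrincipal) := by
  refine ⟨determinantalIdeal_eq_span_signedMinors A, rowMap_signedMinors_comp A,
    ⟨IsExactSeq.depthGE_two, isExactSeq_signedMinors⟩,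
    one_mem_span_signedMinors_of_depthGE_three, fun α h => ?_⟩
  have hdepth := h.depthGE_two
  obtain ⟨a, ha, rfl⟩ := h.exists_eq_smul_signedMinors
  have hgcd := IsStrongGcd.of_smul hdepth ha
  refine ⟨⟨a, ⟨ha, rfl⟩, fun b hb => ?_, hgcd,
      ⟨Submodule.fg_span (Set.finite_range _), fun m b hb => hgcd.of_span_eq hb⟩⟩,
    hdepth, fun h₃ => ?_⟩
  · refine sub_eq_zero.1 (hdepth.isCoregular _ fun i => ?_)
    have := congrFun hb.2 i
    simp only [Pi.smul_apply, smul_eq_mul] at this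
    linear_combination -this
  · have h₁ := one_mem_span_signedMinors_of_depthGE_three h₃
    exact ⟨h₁, isPrincipal_span_smul a h₁⟩
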